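/- Let $K$ be a field and let $\mathbb T$ be the set of terms (monic monomials) in $x_1,\dots,x_n$, where $x_1<\dots<x_n$. Let $\mathcal O\subset\mathbb T$ be a finite order ideal (a finite set of terms closed under taking divisors). Its border is $\partial\mathcal O=\{x_i\tau \mid \tau\in\mathcal O,\ 1\le i\le n\}\setminus\mathcal O$. Let $\mathcal P_{\mathcal O}$ be the Pommaret basis of the monomial ideal generated by $\mathbb T\setminus\mathcal O$, that is, the set of terms $\sigma\notin\mathcal O$ with $\sigma/\min(\sigma)\in\mathcal O$, where $\min(\sigma)$ is the smallest variable dividing $\sigma$. Let $C=\{C_{\tau\sigma}\mid \tau\in\partial\mathcal O,\ \sigma\in\mathcal O\}$ be independent parameters and, for $\tau\in\partial\mathcal O$, let $b_\tau=\tau-\sum_{\sigma\in\mathcal O}C_{\tau\sigma}\sigma\in K[C][x_1,\dots,x_n]$, with head term $\tau$. Let $\tilde C=\{C_{\tau\sigma}\in C\mid \tau\notin\mathcal P_{\mathcal O}\}$. For head terms $\tau,\tau'$ put $S(b_\tau,b_{\tau'})=\eta b_\tau-\eta' b_{\tau'}$, where $\eta\tau=\eta'\tau'=\mathrm{lcm}(\tau,\tau')$.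 Given a set $\mathcal H$ of head terms and, for each $\tau\in\mathcal H$, a set $\mathcal T_\tau\subseteq\mathbb T$ of multiplicative terms, a reduction step replaces a polynomial $g$ by $g-c\,\eta\, b_\tau$, where $\tau\in\mathcal H$, $\eta\in\mathcal T_\tau$ and $c\neq 0$ is the coefficient of $\eta\tau$ in $g$; $g$ reduces to $h$ if $h$ is obtained from $g$ by finitely many (possibly zero) such steps. A polynomial is $\mathcal O$-reduced if all terms of its support in $x_1,\dots,x_n$ lie in $\mathcal O$. Border scheme ideal: list $\partial\mathcal O=\{\beta_1,\dots,\beta_m\}$ by increasing degree, with terms of equal degree in arbitrary order; take $\mathcal H=\partial\mathcal O$ and $\mathcal T_{\beta_i}=\{\eta\in\mathbb T\mid \beta_j\nmid\beta_i\eta \text{ for all } j>i\}$. Let $\mathfrak B\subseteq K[C]$ be the ideal generated by the coefficients in $K[C]$ of the $\mathcal O$-reduced polynomials to which the polynomials $S(b_\tau,b_{\tau'})$ reduce, for all $\tau,\tau'\in\partial\mathcal O$ such that $\tau=x_j\tau'$ for some $j$, or $x_i\tau=x_j\tau'$ for some $i,j$. Pommaret scheme ideal: take $\mathcal H=\mathcal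 P_{\mathcal O}\cap\partial\mathcal O$ (which is $\mathcal P_{\mathcal O}$ if $\mathcal O\neq\emptyset$) and let $\mathcal T_\tau$ be the set of terms in the variables $x_i\le\min(\tau)$. Let $\mathfrak P\subseteq K[C\setminus\tilde C]$ be the ideal generated by the coefficients in $K[C\setminus\tilde C]$ of the $\mathcal O$-reduced polynomials to which the polynomials $S(b_\tau,b_{\tau'})$ reduce, for all $\tau,\tau'\in\mathcal H$ such that $x_i\tau=\delta\tau'$ for some variable $x_i\notin\mathcal T_\tau$ and some $\delta\in\mathcal T_{\tau'}$. Then, for every such listing of $\partial\mathcal O$, $$\mathfrak P=\mathfrak B\cap K[C\setminus\tilde C].$$ -/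

import Mathlib

open MvPolynomial

noncomputable section

namespace MarkedScheme

/-- Terms in `x_1, …, x_n`, written through their exponents: the product of terms is `+`,
`σ ∣ τ` is `σ ≤ τ`, the term `1` is `0` and `x_i` is `Finsupp.single i 1`.
The variables are ordered by `x_1 < … < x_n`. -/
abbrev Term (n : ℕ) := Fin n →₀ ℕ

/-- The border of a finite set of terms: the terms `x_i τ` with `τ ∈ O` which are not in `O`. -/
def border {n : ℕ} (O : Finset (Term n)) : Finset (Term n) :=
  ((O ×ˢ Finset.univ).image fun p : Term n × Fin n => p.1 + Finsupp.single p.2 1) \ O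

/-- The Pommaret basis of the monomial ideal generated by the terms outside the order ideal `O`:
the terms `σ` in that ideal such that `σ / min(σ)` is not in the ideal, where `min(σ)` is the
smallest variable that divides `σ`. -/
def pommaretBasis {n : ℕ} (O : Finset (Term n)) : Set (Term n) :=
  {σ | σ ∉ O ∧ ∀ i, IsLeast (σ.support : Set (Fin n)) i → σ - Finsupp.single i 1 ∈ O}

section Reduction

variable {n : ℕ} {A ι : Type*} [CommRing A]

/-- One step of the reduction relation of the marked polynomials `f a`, with head terms `head a`
and multiplicative sets `mult a`: a term `γ = head a · η` of the support of `g` with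
`η ∈ mult a` is chosen, and `h = g - c η (f a)`, where `c` is the coefficient of `γ` in `g`. -/
def ReductionStep (head : ι → Term n) (mult : ι → Set (Term n))
    (f : ι → MvPolynomial (Fin n) A) (g h : MvPolynomial (Fin n) A) : Prop :=
  ∃ a, ∃ η ∈ mult a, head a + η ∈ g.support ∧
    h = g - monomial η (coeff (head a + η) g) * f a

/-- `g` reduces to `h` in finitely many (possibly zero) steps. -/
def Reduces (head : ι → Term n) (mult : ι → Set (Term n))
    (f : ι → MvPolynomial (Fin n) A) (g h : MvPolynomial (Fin n) A) : Prop :=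
  Relation.ReflTransGen (ReductionStep head mult f) g h

/-- `h` is `O`-reduced: all terms of its support are in `O`. -/
def IsReduced (O : Finset (Term n)) (h : MvPolynomial (Fin n) A) : Prop :=
  h.support ⊆ O

/-- The `S`-polynomial of `f` and `f'`, marked at the terms `α` and `α'`; here `α ⊔ α'` is the
least common multiple of `α` and `α'`. -/
def sPoly (α α' : Term n) (f f' : MvPolynomial (Fin n) A) : MvPolynomial (Fin n) A :=
  monomial (α ⊔ α' - α) 1 * f - monomial (α ⊔ α' - α') 1 * f'

end Reduction

/-- `(α, α')` is a neighbour couple: `α = x_j α'` or `x_i α = x_j α'` for some variables. -/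
def IsNeighbourCouple {n : ℕ} (α α' : Term n) : Prop :=
  (∃ j, α = Finsupp.single j 1 + α') ∨
    ∃ i j, Finsupp.single i 1 + α = Finsupp.single j 1 + α'

/-- `(α, α')` is a non-multiplicative couple with respect to multiplicative sets `mult`: there is
a variable `x_i ∉ mult α` such that `x_i α` is in the cone of `α'` by `mult α'`. -/
def IsNonMultCouple {n : ℕ} (mult : Term n → Set (Term n)) (α α' : Term n) : Prop :=
  ∃ i, Finsupp.single i 1 ∉ mult α ∧ ∃ δ ∈ mult α', Finsupp.single i 1 + α = α' + δ

/-- The parameters `C`: one for each pair of a term `τ` of the border and a term `σ` of `O`. -/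
abbrev Param {n : ℕ} (O : Finset (Term n)) := border O × O

/-- The generic border marked set: `b_τ = τ - ∑_{σ ∈ O} C_{τσ} σ` for `τ` in the border, with
coefficients in `K[C]`. -/
def genericBorder (K : Type*) [Field K] {n : ℕ} (O : Finset (Term n)) (τ : border O) :
    MvPolynomial (Fin n) (MvPolynomial (Param O) K) :=
  monomial (τ : Term n) 1 - ∑ σ : O, monomial (σ : Term n) (X (τ, σ))

/-- The multiplicative sets of the border reduction structure, where `β` lists the terms of the
border: `η` is multiplicative for `β_i` if no `β_j` with `j > i` divides `β_i η`. -/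
def borderMult {n : ℕ} {O : Finset (Term n)} {m : ℕ} (β : Fin m ≃ border O) (τ : border O) :
    Set (Term n) :=
  {η | ∀ j, β.symm τ < j → ¬ (β j : Term n) ≤ (τ : Term n) + η}

/-- The ideal `𝔅 ⊆ K[C]` of the border marked scheme: it is generated by the `x`-coefficients of
the `O`-reduced polynomials to which the `S`-polynomials of the neighbour couples reduce by the
generic border marked set. -/
def borderIdeal (K : Type*) [Field K] {n : ℕ} (O : Finset (Term n)) {m : ℕ}
    (β : Fin m ≃ border O) : Ideal (MvPolynomial (Param O) K) :=
  Ideal.span {c | ∃ r s : border O, IsNeighbourCouple (r : Term n) s ∧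
    ∃ h, Reduces (fun τ : border O => (τ : Term n)) (borderMult β) (genericBorder K O)
        (sPoly (r : Term n) s (genericBorder K O r) (genericBorder K O s)) h ∧
      IsReduced O h ∧ ∃ μ, c = coeff μ h}

/-- The parameters `C̃`: those of the marked polynomials whose head term is in the border but not
in the Pommaret basis. -/
def elimParam {n : ℕ} (O : Finset (Term n)) : Set (Param O) :=
  {c | (c.1 : Term n) ∉ pommaretBasis O}

/-- The terms of the border which are in the Pommaret basis. For a nonempty order ideal `O` these
are all the terms of the Pommaret basis. -/
abbrev PommaretHead {n : ℕ} (O : Finset (Term n)) :=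
  {τ : border O // (τ : Term n) ∈ pommaretBasis O}

/-- The generic Pommaret marked set: the elements of the generic border marked set with head term
in the Pommaret basis, as polynomials with coefficients in `K[C ∖ C̃]`. -/
def genericPommaret (K : Type*) [Field K] {n : ℕ} (O : Finset (Term n)) (τ : PommaretHead O) :
    MvPolynomial (Fin n) (MvPolynomial ↥(elimParam O)ᶜ K) :=
  monomial (τ.1 : Term n) 1 -
    ∑ σ : O, monomial (σ : Term n) (X ⟨(τ.1, σ), fun h => h τ.2⟩)

/-- The multiplicative set of the term `α` in the Pommaret reduction structure: the terms in the
variables that are not larger than `min(α)`. -/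
def pommaretMult {n : ℕ} (α : Term n) : Set (Term n) :=
  {η | ∀ j ∈ η.support, ∀ k ∈ α.support, j ≤ k}

/-- The ideal `𝔓 ⊆ K[C ∖ C̃]` of the Pommaret marked scheme: it is generated by the
`x`-coefficients of the `O`-reduced polynomials to which the `S`-polynomials of the
non-multiplicative couples reduce by the generic Pommaret marked set. -/
def pommaretIdeal (K : Type*) [Field K] {n : ℕ} (O : Finset (Term n)) :
    Ideal (MvPolynomial ↥(elimParam O)ᶜ K) :=
  Ideal.span {c | ∃ r s : PommaretHead O,
    IsNonMultCouple pommaretMult (r.1 : Term n) (s.1 : Term n) ∧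
    ∃ h, Reduces (fun τ : PommaretHead O => (τ.1 : Term n))
        (fun τ : PommaretHead O => pommaretMult (τ.1 : Term n)) (genericPommaret K O)
        (sPoly (r.1 : Term n) s.1 (genericPommaret K O r) (genericPommaret K O s)) h ∧
      IsReduced O h ∧ ∃ μ, c = coeff μ h}

end MarkedScheme

end

/-! Each of the two scheme ideals contains the coefficients of every `O`-reduced polynomial in the
ideal spanned by its generic marked set (`coeff_mem_borderIdeal`, `coeff_mem_pommaretIdeal`), and
its generators are such coefficients, because reduction and S-polynomials stay inside that ideal.
The particular syzygies and reduction structures therefore drop out, and the two ideals can be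
compared along ring maps of the parameters.

The inclusion of `K[C ∖ C̃]` in `K[C]` sends the Pommaret marked set into the border marked set, so
`𝔓 ⊆ 𝔅`. Conversely, sending each parameter `C_{τσ}` of `C̃` to the coefficient of `σ` in a Pommaret
normal form of `τ` defines a retraction `φ : K[C] → K[C ∖ C̃]`. It maps every `b_τ` into the
Pommaret ideal, hence `φ(𝔅) ⊆ 𝔓`, and an element `f` of the contraction of `𝔅` satisfies `f = φ(f) ∈
𝔓`.

On the border side, the neighbour syzygies modulo `𝔅` make the formal multiplication operators
commute. Polynomials then act through these operators: the border polynomials kill `1`, while an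
`O`-reduced `h` sends `1` to `h`; so `h` vanishes modulo `𝔅` if it lies in the ideal of the border
set.

On the Pommaret side, every multiple of a marked polynomial is rewritten, modulo the coefficients of
the syzygies, as a combination of multiplicative multiples, by induction on the multiplier in the
lexicographic order. A linear normal form kills these multiples and fixes `O`-reduced polynomials.
-/

namespace MarkedScheme

/-! ### Marked polynomials and termination of reduction. -/

section MarkedPoly

variable {n : ℕ} {A : Type*} [CommRing A]

/-- The polynomial `τ - ∑_{σ ∈ O} c_σ σ`, marked at the term `τ`. -/
noncomputable def markedPoly (O : Finset (Term n)) (τ : Term n) (c : O → A) :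
    MvPolynomial (Fin n) A :=
  monomial τ 1 - ∑ σ : O, monomial (σ : Term n) (c σ)

theorem monomial_eq_smul_one {σ : Type*} (γ : σ →₀ ℕ) (a : A) :
    (monomial γ a : MvPolynomial σ A) = a • monomial γ 1 := by
  rw [smul_monomial, smul_eq_mul, mul_one]

theorem monomial_mul_markedPoly (O : Finset (Term n)) (τ η : Term n) (c : O → A) (a : A) :
    monomial η a * markedPoly O τ c =
      monomial (η + τ) a - ∑ σ : O, monomial (η + σ : Term n) (a * c σ) := by
  simp [markedPoly, mul_sub, Finset.mul_sum, monomial_mul]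

theorem map_markedPoly {B : Type*} [CommRing B] (φ : A →+* B) (O : Finset (Term n)) (τ : Term n)
    (c : O → A) :
    MvPolynomial.map φ (markedPoly O τ c) = markedPoly O τ (fun σ => φ (c σ)) := by
  simp [markedPoly, map_monomial]

theorem genericBorder_eq (K : Type*) [Field K] (O : Finset (Term n)) (τ : border O) :
    genericBorder K O τ = markedPoly O τ fun σ => X (τ, σ) := rfl

theorem genericPommaret_eq (K : Type*) [Field K] (O : Finset (Term n)) (τ : PommaretHead O) :
    genericPommaret K O τ = markedPoly O τ.1 fun σ => X ⟨(τ.1, σ), fun h => h τ.2⟩ := rfl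

theorem IsReduced.eq_sum {O : Finset (Term n)} {h : MvPolynomial (Fin n) A} (hh : IsReduced O h) :
    h = ∑ σ : O, monomial (σ : Term n) (coeff σ h) := by
  conv_lhs => rw [h.as_sum]
  rw [Finset.sum_subset hh fun x _ hx => by simp [notMem_support_iff.1 hx]]
  exact (Finset.sum_coe_sort O fun σ => monomial σ (coeff σ h)).symm

theorem IsReduced.map {B : Type*} [CommRing B] (φ : A →+* B) {O : Finset (Term n)}
    {h : MvPolynomial (Fin n) A} (hh : IsReduced O h) : IsReduced O (MvPolynomial.map φ h) :=
  (support_map_subset φ h).trans hh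

theorem Reduces.sub_mem {ι : Type*} {head : ι → Term n} {mult : ι → Set (Term n)}
    {f : ι → MvPolynomial (Fin n) A} {g h : MvPolynomial (Fin n) A}
    (H : Reduces head mult f g h) : g - h ∈ Ideal.span (Set.range f) := by
  induction H with
  | refl => simp
  | tail _ hs ih =>
    obtain ⟨a, η, -, -, rfl⟩ := hs
    rw [sub_sub_eq_add_sub, add_sub_right_comm]
    exact add_mem ih (Ideal.mul_mem_left _ _ (Ideal.subset_span ⟨a, rfl⟩))

theorem sPoly_mem_span {ι : Type*} (f : ι → MvPolynomial (Fin n) A) (α α' : Term n) (a b : ι) :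
    sPoly α α' (f a) (f b) ∈ Ideal.span (Set.range f) :=
  sub_mem (Ideal.mul_mem_left _ _ (Ideal.subset_span ⟨a, rfl⟩))
    (Ideal.mul_mem_left _ _ (Ideal.subset_span ⟨b, rfl⟩))

theorem Reduces.mem_span_of_sPoly {ι : Type*} {head : ι → Term n} {mult : ι → Set (Term n)}
    {f : ι → MvPolynomial (Fin n) A} {h : MvPolynomial (Fin n) A} {α α' : Term n} {a b : ι}
    (H : Reduces head mult f (sPoly α α' (f a) (f b)) h) : h ∈ Ideal.span (Set.range f) := by
  rw [← sub_sub_self (sPoly α α' (f a) (f b)) h]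
  exact _root_.sub_mem (sPoly_mem_span f α α' a b) H.sub_mem

theorem map_mem_span_range {B ι κ : Type*} [CommRing B] (φ : A →+* B)
    {f : ι → MvPolynomial (Fin n) A} {g : κ → MvPolynomial (Fin n) B}
    (hfg : ∀ a, MvPolynomial.map φ (f a) ∈ Ideal.span (Set.range g))
    {h : MvPolynomial (Fin n) A} (hh : h ∈ Ideal.span (Set.range f)) :
    MvPolynomial.map φ h ∈ Ideal.span (Set.range g) := by
  have : Ideal.span (Set.range f) ≤ (Ideal.span (Set.range g)).comap (MvPolynomial.map φ) :=
    Ideal.span_le.2 (Set.range_subset_iff.2 hfg)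
  exact this hh

/-- A polynomial with support in `Γ` reduces to an `O`-reduced one if every term of `Γ` outside
`O` can be replaced by terms of `Γ` that are in `O` or smaller in a well-founded relation. -/
theorem exists_reduces {ι : Type*} {O : Finset (Term n)} {head : ι → Term n}
    {mult : ι → Set (Term n)} {c : ι → O → A} {Γ : Set (Term n)}
    {r : Term n → Term n → Prop} (hr : WellFounded r) {S : Set (ι × Term n)}
    (hS : ∀ p ∈ S, p.2 ∈ mult p.1)
    (H : ∀ γ ∈ Γ, γ ∉ O → ∃ p ∈ S, head p.1 + p.2 = γ ∧
      ∀ σ ∈ O, p.2 + σ ∈ Γ ∧ (p.2 + σ ∉ O → r (p.2 + σ) γ))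
    (g : MvPolynomial (Fin n) A) (hg : (g.support : Set (Term n)) ⊆ Γ) :
    ∃ h, Reduces head mult (fun a => markedPoly O (head a) (c a)) g h ∧ IsReduced O h ∧
      g - h ∈ Submodule.span A
        ((fun p : ι × Term n => monomial p.2 1 * markedPoly O (head p.1) (c p.1)) '' S) := by
  classical
  -- Termination is a multiset argument: `M` bounds the nonreduced terms of `g`, and a step trades
  -- one occurrence of `γ` for finitely many `r`-smaller terms.
  suffices ∀ M : Multiset (Term n), ∀ g : MvPolynomial (Fin n) A,
      (g.support : Set (Term n)) ⊆ Γ → (∀ γ ∈ g.support, γ ∉ O → γ ∈ M) →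
      ∃ h, Reduces head mult (fun a => markedPoly O (head a) (c a)) g h ∧ IsReduced O h ∧
      g - h ∈ Submodule.span A
        ((fun p : ι × Term n => monomial p.2 1 * markedPoly O (head p.1) (c p.1)) '' S) from
    this g.support.val g hg fun γ h _ => h
  intro M
  induction M using (WellFounded.cutExpand hr).induction with
  | _ M ih =>
  intro g hg hM
  by_cases hred : IsReduced O g
  · exact ⟨g, .refl, hred, by simp⟩
  obtain ⟨γ, hγ, hγO⟩ := Finset.not_subset.1 hred
  obtain ⟨p, hp, rfl, hσ⟩ := H γ (hg hγ) hγO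
  set γ := head p.1 + p.2 with hγdef
  set a := coeff γ g with ha
  set g' := g - monomial p.2 a * markedPoly O (head p.1) (c p.1) with hg'
  have hg'eq : g' = g - monomial γ a + ∑ σ : O, monomial (p.2 + σ : Term n) (a * c p.1 σ) := by
    rw [hg', monomial_mul_markedPoly, add_comm p.2]
    ring
  have hsupp : ∀ δ ∈ g'.support, (δ ∈ g.support ∧ δ ≠ γ) ∨ ∃ σ ∈ O, p.2 + σ = δ := by
    intro δ hδ
    by_contra hcon
    push Not at hcon
    rw [mem_support_iff, hg'eq, coeff_add, coeff_sub, coeff_sum] at hδ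
    rw [Finset.sum_eq_zero fun σ _ => by
      rw [coeff_monomial, if_neg (hcon.2 σ σ.2)], add_zero, coeff_monomial] at hδ
    by_cases hd : δ = γ
    · subst hd; simp [ha] at hδ
    · rw [if_neg (Ne.symm hd), sub_zero] at hδ
      exact hd (hcon.1 (mem_support_iff.2 hδ))
  obtain ⟨h, h1, h2, h3⟩ := ih
    (M.erase γ + ((O.image fun σ => p.2 + σ).filter fun δ => δ ∉ O).val)
    ⟨((O.image fun σ => p.2 + σ).filter fun δ => δ ∉ O).val, γ, by
      intro δ hδ
      simp only [Finset.mem_val, Finset.mem_filter, Finset.mem_image] at hδ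
      obtain ⟨⟨σ, hσO, rfl⟩, hn⟩ := hδ
      exact (hσ σ hσO).2 hn, by
      rw [add_right_comm, add_comm (M.erase γ), Multiset.singleton_add,
        Multiset.cons_erase (hM γ hγ hγO)]⟩ g'
    (by
      intro δ hδ
      rcases hsupp δ hδ with h | ⟨σ, hσO, rfl⟩
      · exact hg h.1
      · exact (hσ σ hσO).1)
    (by
      intro δ hδ hδO
      rw [Multiset.mem_add]
      rcases hsupp δ hδ with h | ⟨σ, hσO, rfl⟩
      · exact .inl ((Multiset.mem_erase_of_ne h.2).2 (hM δ h.1 hδO))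
      · right
        simp only [Finset.mem_val, Finset.mem_filter, Finset.mem_image]
        exact ⟨⟨σ, hσO, rfl⟩, hδO⟩)
  refine ⟨h, .head ⟨p.1, p.2, hS p hp, hγ, rfl⟩ h1, h2, ?_⟩
  have : g - h = g' - h + a • (monomial p.2 1 * markedPoly O (head p.1) (c p.1)) := by
    rw [hg', ← smul_mul_assoc, smul_monomial, smul_eq_mul, mul_one]
    ring
  rw [this]
  exact add_mem h3 (Submodule.smul_mem _ _ (Submodule.subset_span ⟨p, hp, rfl⟩))

end MarkedPoly

/-! ### Commuting multiplication operators on the span of `O`. -/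

section Border

variable {n : ℕ} {A : Type*} [CommRing A]

theorem mem_border {O : Finset (Term n)} {τ : Term n} :
    τ ∈ border O ↔ (∃ σ ∈ O, ∃ i, σ + Finsupp.single i 1 = τ) ∧ τ ∉ O := by
  simp [border]

theorem single_add_sup_sub {i j : Fin n} (hij : i ≠ j) {r s : Term n}
    (h : Finsupp.single i 1 + r = Finsupp.single j 1 + s) :
    r ⊔ s - r = Finsupp.single i 1 ∧ r ⊔ s - s = Finsupp.single j 1 := by
  have key : ∀ k, (Finsupp.single i 1 : Term n) k + r k = (Finsupp.single j 1 : Term n) k + s k :=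
    fun k => DFunLike.congr_fun h k
  constructor <;> ext k <;> have := key k <;> revert this <;>
    simp only [Finsupp.single_apply, Finsupp.coe_tsub, Pi.sub_apply, Finsupp.sup_apply] <;>
    split_ifs <;> simp_all <;> omega

/-- The linear map that is the identity on the terms in `O`, replaces a border term `τ` by
`∑ c_{τσ} σ`, and kills the other terms. -/
noncomputable def borderNF (O : Finset (Term n)) (c : border O → O → A) :
    MvPolynomial (Fin n) A →ₗ[A] MvPolynomial (Fin n) A :=
  open Classical in
  (basisMonomials (Fin n) A).constr A fun γ =>
    if γ ∈ O then monomial γ 1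
    else if h : γ ∈ border O then ∑ σ : O, monomial (σ : Term n) (c ⟨γ, h⟩ σ) else 0

/-- Multiplication by a variable on the span of `O`, followed by `borderNF`. -/
noncomputable def borderMul (O : Finset (Term n)) (c : border O → O → A) (i : Fin n) :
    Module.End A (MvPolynomial (Fin n) A) :=
  open Classical in
  (basisMonomials (Fin n) A).constr A fun γ =>
    if γ ∈ O then borderNF O c (monomial (γ + Finsupp.single i 1) 1) else 0

variable {O : Finset (Term n)} {c : border O → O → A}

theorem borderNF_monomial_of_mem {γ : Term n} (h : γ ∈ O) (a : A) :
    borderNF O c (monomial γ a) = monomial γ a := by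
  have := (basisMonomials (Fin n) A).constr_basis A (fun γ => open Classical in
    if γ ∈ O then monomial γ 1
    else if h : γ ∈ border O then ∑ σ : O, monomial (σ : Term n) (c ⟨γ, h⟩ σ) else 0) γ
  rw [if_pos h, coe_basisMonomials] at this
  rw [show (monomial γ a : MvPolynomial (Fin n) A) = a • monomial γ 1 by simp [smul_monomial],
    map_smul]
  exact congrArg _ this

theorem borderNF_border (τ : border O) :
    borderNF O c (monomial (τ : Term n) 1) = ∑ σ : O, monomial (σ : Term n) (c τ σ) := by
  have := (basisMonomials (Fin n) A).constr_basis A (fun γ => open Classical in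
    if γ ∈ O then monomial γ 1
    else if h : γ ∈ border O then ∑ σ : O, monomial (σ : Term n) (c ⟨γ, h⟩ σ) else 0) τ
  rw [if_neg (mem_border.1 τ.2).2, dif_pos τ.2, coe_basisMonomials] at this
  exact this

theorem borderNF_markedPoly (τ : border O) : borderNF O c (markedPoly O τ (c τ)) = 0 := by
  rw [markedPoly, map_sub, borderNF_border, map_sum, sub_eq_zero]
  exact Finset.sum_congr rfl fun σ _ => (borderNF_monomial_of_mem σ.2 _).symm

theorem borderMul_monomial_of_mem {γ : Term n} (h : γ ∈ O) (i : Fin n) (a : A) :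
    borderMul O c i (monomial γ a) = borderNF O c (monomial (γ + Finsupp.single i 1) a) := by
  have := (basisMonomials (Fin n) A).constr_basis A (fun γ => open Classical in
    if γ ∈ O then borderNF O c (monomial (γ + Finsupp.single i 1) 1) else 0) γ
  rw [if_pos h, coe_basisMonomials] at this
  have e : ∀ δ : Term n, (monomial δ a : MvPolynomial (Fin n) A) = a • monomial δ 1 := by
    simp [smul_monomial]
  rw [e γ, e (_ + _), map_smul, map_smul]
  exact congrArg _ this

theorem borderMul_monomial_of_notMem {γ : Term n} (h : γ ∉ O) (i : Fin n) :
    borderMul O c i (monomial γ 1) = 0 := by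
  have := (basisMonomials (Fin n) A).constr_basis A (fun γ => open Classical in
    if γ ∈ O then borderNF O c (monomial (γ + Finsupp.single i 1) 1) else 0) γ
  rw [if_neg h, coe_basisMonomials] at this
  exact this

theorem borderMul_of_isReduced {h : MvPolynomial (Fin n) A} (hh : IsReduced O h) (i : Fin n) :
    borderMul O c i h = borderNF O c (monomial (Finsupp.single i 1) 1 * h) := by
  rw [hh.eq_sum, map_sum, Finset.mul_sum, map_sum]
  refine Finset.sum_congr rfl fun σ _ => ?_
  rw [borderMul_monomial_of_mem σ.2, monomial_mul, one_mul, add_comm]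

theorem isReduced_sum (v : O → A) : IsReduced O (∑ σ : O, monomial (σ : Term n) (v σ)) := by
  classical
  intro γ hγ
  by_contra hn
  rw [mem_support_iff, coeff_sum] at hγ
  refine hγ (Finset.sum_eq_zero fun σ _ => ?_)
  rw [coeff_monomial, if_neg]
  rintro rfl
  exact hn σ.2

/-- The `S`-polynomials of the neighbour couples vanish under `borderNF`. -/
def NeighbourSyzygies (c : border O → O → A) : Prop :=
  ∀ r s : border O, IsNeighbourCouple (r : Term n) s →
    borderNF O c (sPoly (r : Term n) s (markedPoly O r (c r)) (markedPoly O s (c s))) = 0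

theorem NeighbourSyzygies.mul_eq_of_single_add (H : NeighbourSyzygies c) {r s : border O}
    {j : Fin n} (h : (r : Term n) = Finsupp.single j 1 + (s : Term n)) :
    borderNF O c (monomial (Finsupp.single j 1) 1 * ∑ σ : O, monomial (σ : Term n) (c s σ)) =
      ∑ σ : O, monomial (σ : Term n) (c r σ) := by
  have := H r s (.inl ⟨j, h⟩)
  have hsup : (r : Term n) ⊔ s = r := sup_eq_left.2 (h ▸ le_add_self)
  rw [sPoly, hsup, tsub_self, h, add_tsub_cancel_right, ← h, map_sub, ← C_apply, C_1, one_mul,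
    borderNF_markedPoly, zero_sub, neg_eq_zero, markedPoly, mul_sub, map_sub, sub_eq_zero,
    monomial_mul, ← h, one_mul, borderNF_border] at this
  exact this.symm

theorem NeighbourSyzygies.mul_eq_mul (H : NeighbourSyzygies c) {r s : border O}
    {i j : Fin n} (h : Finsupp.single i 1 + (r : Term n) = Finsupp.single j 1 + (s : Term n)) :
    borderNF O c (monomial (Finsupp.single i 1) 1 * ∑ σ : O, monomial (σ : Term n) (c r σ)) =
    borderNF O c (monomial (Finsupp.single j 1) 1 * ∑ σ : O, monomial (σ : Term n) (c s σ)) := by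
  by_cases hij : i = j
  · subst hij
    rw [Subtype.ext (add_left_cancel h)]
  have := H r s (.inr ⟨i, j, h⟩)
  rw [sPoly, (single_add_sup_sub hij h).1, (single_add_sup_sub hij h).2, markedPoly, markedPoly,
    mul_sub, mul_sub, monomial_mul, monomial_mul, h, sub_sub_sub_cancel_left, map_sub,
    sub_eq_zero] at this
  exact this.symm

/-- On a term `γ ∈ O` only three cases arise. If `x_i γ` and `x_j γ` are both in `O`, both orders
give the same term. If just one is, `x_i x_j γ` and the other product are border terms that differ
by one variable. If neither is, they are border terms with a common multiple `x_i x_j γ`. The last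
two cases are exactly the two kinds of neighbour couples. -/
theorem NeighbourSyzygies.borderMul_comm (hO : IsLowerSet (O : Set (Term n)))
    (H : NeighbourSyzygies c) (i j : Fin n) :
    borderMul O c i * borderMul O c j = borderMul O c j * borderMul O c i := by
  refine (basisMonomials (Fin n) A).ext fun γ => ?_
  rw [coe_basisMonomials, Module.End.mul_apply, Module.End.mul_apply]
  by_cases hγ : γ ∈ O
  swap
  · simp [borderMul_monomial_of_notMem hγ]
  have hb : ∀ {k : Fin n} {σ : Term n}, σ ∈ O → σ + Finsupp.single k 1 ∉ O →
      σ + Finsupp.single k 1 ∈ border O := fun {k σ} h1 h2 => mem_border.2 ⟨⟨σ, h1, k, rfl⟩, h2⟩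
  have key : ∀ i j : Fin n, γ + Finsupp.single i 1 ∈ O → γ + Finsupp.single j 1 ∉ O →
      borderMul O c i (borderMul O c j (monomial γ 1)) =
        borderMul O c j (borderMul O c i (monomial γ 1)) := by
    intro i j hi hj
    have hij : γ + Finsupp.single i 1 + Finsupp.single j 1 ∉ O := fun h =>
      hj (hO (add_right_comm γ (Finsupp.single i 1) _ ▸ le_self_add) h)
    rw [borderMul_monomial_of_mem hγ, borderMul_monomial_of_mem hγ,
      borderNF_monomial_of_mem hi, borderMul_monomial_of_mem hi,
      borderNF_border ⟨_, hb hi hij⟩, borderNF_border ⟨_, hb hγ hj⟩,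
      borderMul_of_isReduced (isReduced_sum _)]
    refine H.mul_eq_of_single_add ?_
    change γ + _ + _ = _
    rw [add_comm _ (γ + _), add_right_comm]
  by_cases hi : γ + Finsupp.single i 1 ∈ O <;> by_cases hj : γ + Finsupp.single j 1 ∈ O
  · rw [borderMul_monomial_of_mem hγ, borderMul_monomial_of_mem hγ,
      borderNF_monomial_of_mem hi, borderNF_monomial_of_mem hj, borderMul_monomial_of_mem hi,
      borderMul_monomial_of_mem hj, add_right_comm]
  · exact key i j hi hj
  · exact (key j i hj hi).symm
  · rw [borderMul_monomial_of_mem hγ, borderMul_monomial_of_mem hγ,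
      borderNF_border ⟨_, hb hγ hi⟩, borderNF_border ⟨_, hb hγ hj⟩,
      borderMul_of_isReduced (isReduced_sum _), borderMul_of_isReduced (isReduced_sum _)]
    refine H.mul_eq_mul ?_
    change _ + (γ + _) = _ + (γ + _)
    abel

open scoped IsMulCommutative in
theorem exists_algHom_of_commute {M : Type*} [AddCommGroup M] [Module A M] {ι : Type*}
    (T : ι → Module.End A M) (hT : ∀ i j, T i * T j = T j * T i) :
    ∃ F : MvPolynomial ι A →ₐ[A] Module.End A M, ∀ i, F (X i) = T i := by
  have hc : ∀ x ∈ Set.range T, ∀ y ∈ Set.range T, x * y = y * x := by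
    rintro _ ⟨i, rfl⟩ _ ⟨j, rfl⟩
    exact hT i j
  have := Algebra.isMulCommutative_adjoin A hc
  refine ⟨(Algebra.adjoin A (Set.range T)).val.comp
    (aeval fun i => (⟨T i, Algebra.subset_adjoin ⟨i, rfl⟩⟩ : Algebra.adjoin A (Set.range T))),
    fun i => ?_⟩
  simp

/-- If the neighbour syzygies hold, no nonzero `O`-reduced polynomial is in the ideal of the
border marked set. -/
theorem NeighbourSyzygies.eq_zero (hO : IsLowerSet (O : Set (Term n)))
    (H : NeighbourSyzygies c) {h : MvPolynomial (Fin n) A} (hh : IsReduced O h)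
    (hI : h ∈ Ideal.span (Set.range fun τ : border O => markedPoly O τ (c τ))) : h = 0 := by
  obtain ⟨F, hF⟩ := exists_algHom_of_commute _ (H.borderMul_comm hO)
  have hadd : ∀ (σ : Term n) i, F (monomial (σ + Finsupp.single i 1) 1) (monomial 0 1) =
      borderMul O c i (F (monomial σ 1) (monomial 0 1)) := by
    intro σ i
    rw [add_comm, monomial_single_add, pow_one, map_mul, hF, Module.End.mul_apply]
  -- Since `O` is closed under divisors, `σ` is built from `1` one variable at a time without
  -- leaving `O`, where the operators are honest multiplication.
  have hmem : ∀ σ : Term n, σ ∈ O → F (monomial σ 1) (monomial 0 1) = monomial σ 1 := by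
    intro σ
    induction σ using WellFoundedLT.induction with
    | _ σ ih =>
    intro hσ
    obtain rfl | hne := eq_or_ne σ 0
    · have h1 : F (monomial 0 1) = 1 := by rw [← C_apply, C_1, map_one]
      rw [h1, Module.End.one_apply]
    obtain ⟨i, hi⟩ := Finsupp.ne_iff.1 hne
    obtain ⟨τ, rfl⟩ : ∃ τ, σ = τ + Finsupp.single i 1 :=
      ⟨_, (tsub_add_cancel_of_le (Finsupp.single_le_iff.2 (Nat.one_le_iff_ne_zero.2 hi))).symm⟩
    have hτ : τ ∈ O := hO le_self_add hσ
    rw [hadd, ih τ (lt_add_of_pos_right _ (by simp [pos_iff_ne_zero])) hτ,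
      borderMul_monomial_of_mem hτ, borderNF_monomial_of_mem hσ]
  have hsm : ∀ (σ : Term n) (a : A), F (monomial σ a) (monomial 0 1) =
      a • F (monomial σ 1) (monomial 0 1) := by
    intro σ a
    rw [← LinearMap.smul_apply, ← map_smul, smul_monomial, smul_eq_mul, mul_one]
  have hred : ∀ g, IsReduced O g → F g (monomial 0 1) = g := by
    intro g hg
    rw [hg.eq_sum, map_sum, LinearMap.sum_apply]
    refine Finset.sum_congr rfl fun σ _ => ?_
    rw [hsm, hmem σ σ.2, smul_monomial, smul_eq_mul, mul_one]
  have hker : ∀ τ : border O, F (markedPoly O τ (c τ)) (monomial 0 1) = 0 := by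
    intro τ
    obtain ⟨⟨σ, hσ, i, hi⟩, -⟩ := mem_border.1 τ.2
    rw [markedPoly, map_sub, LinearMap.sub_apply, hred _ (isReduced_sum _), ← hi, hadd,
      hmem σ hσ, borderMul_monomial_of_mem hσ, hi, borderNF_border, sub_self]
  rw [← hred h hh]
  obtain ⟨f, rfl⟩ := Ideal.mem_span_range_iff_exists_fun.1 hI
  rw [map_sum, LinearMap.sum_apply]
  exact Finset.sum_eq_zero fun τ _ => by
    rw [map_mul, Module.End.mul_apply, hker, map_zero]

end Border

/-! ### The border scheme ideal and its neighbour syzygies. -/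

section BorderIdeal

variable {n : ℕ} {K : Type*} [Field K] {O : Finset (Term n)} {m : ℕ}

/-- This is where the listing by increasing degree matters: a later border term dividing `τ` would
have at least the degree of `τ`, hence equal it. -/
theorem zero_mem_borderMult (β : Fin m ≃ border O)
    (hβ : Monotone fun i => Finsupp.degree (β i : Term n)) (τ : border O) :
    0 ∈ borderMult β τ := by
  intro j hj hle
  rw [add_zero] at hle
  have h1 : Finsupp.degree (τ : Term n) ≤ Finsupp.degree (β j : Term n) := by
    simpa using hβ hj.le
  have : (β j : Term n) = τ := by
    obtain ⟨δ, hδ⟩ := exists_add_of_le hle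
    rw [hδ, map_add] at h1
    have : Finsupp.degree δ = 0 := by omega
    rw [hδ, (Finsupp.degree_eq_zero_iff δ).1 this, add_zero]
  rw [← Subtype.ext this, Equiv.symm_apply_apply] at hj
  exact lt_irrefl _ hj

/-- The `S`-polynomial of a neighbour couple has its support in `O` and its border. -/
theorem sPoly_neighbour_support {A : Type*} [CommRing A] (c : border O → O → A) {r s : border O}
    (h : IsNeighbourCouple (r : Term n) s) :
    ((sPoly (r : Term n) s (markedPoly O r (c r)) (markedPoly O s (c s))).support : Set (Term n)) ⊆
      {γ | γ ∈ O ∨ γ ∈ border O} := by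
  have hb : ∀ (k : Fin n) (σ : O), Finsupp.single k 1 + (σ : Term n) ∈
      {γ | γ ∈ O ∨ γ ∈ border O} := by
    intro k σ
    by_cases h : Finsupp.single k 1 + (σ : Term n) ∈ O
    · exact .inl h
    · exact .inr (mem_border.2 ⟨⟨σ, σ.2, k, add_comm _ _⟩, h⟩)
  have hs : ∀ (k : Fin n) (v : O → A), ∑ σ : O, monomial (Finsupp.single k 1 + (σ : Term n)) (v σ) ∈
      restrictSupport A {γ | γ ∈ O ∨ γ ∈ border O} := fun k v =>
    Submodule.sum_mem _ fun σ _ => (monomial_mem_restrictSupport A).2 (.inl (hb k σ))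
  rw [← mem_restrictSupport_iff A]
  by_cases hrs : r = s
  · subst hrs
    simp [sPoly]
  rcases h with ⟨j, h⟩ | ⟨i, j, h⟩
  · have hsup : (r : Term n) ⊔ s = r := sup_eq_left.2 (h ▸ le_add_self)
    have e : (r : Term n) - (s : Term n) = Finsupp.single j 1 := by rw [h, add_tsub_cancel_right]
    rw [sPoly, hsup, tsub_self, e, ← C_apply, C_1, one_mul, monomial_mul_markedPoly, ← h,
      markedPoly, sub_sub_sub_cancel_left]
    refine sub_mem (hs j _) (Submodule.sum_mem _ fun σ _ =>
      (monomial_mem_restrictSupport A).2 (.inl (.inl σ.2)))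
  · have hij : i ≠ j := by
      rintro rfl
      exact hrs (Subtype.ext (add_left_cancel h))
    rw [sPoly, (single_add_sup_sub hij h).1, (single_add_sup_sub hij h).2,
      monomial_mul_markedPoly, monomial_mul_markedPoly, h, sub_sub_sub_cancel_left]
    exact sub_mem (hs _ _) (hs _ _)

theorem borderNF_map_eq_zero {R A : Type*} [CommRing R] [CommRing A] (φ : R →+* A)
    {c : border O → O → R} {g : MvPolynomial (Fin n) R}
    (hg : g ∈ Submodule.span R ((fun p : border O × Term n =>
      monomial p.2 1 * markedPoly O p.1 (c p.1)) '' {p | p.2 = 0})) :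
    borderNF O (fun τ σ => φ (c τ σ)) (MvPolynomial.map φ g) = 0 := by
  induction hg using Submodule.span_induction with
  | mem x hx =>
    obtain ⟨⟨τ, η⟩, hη, rfl⟩ := hx
    obtain rfl : η = 0 := hη
    dsimp only
    rw [← C_apply, C_1, one_mul, map_markedPoly]
    exact borderNF_markedPoly (c := fun τ σ => φ (c τ σ)) τ
  | zero => simp
  | add x y _ _ hx hy => rw [map_add, map_add, hx, hy, add_zero]
  | smul a x _ hx => rw [smul_eq_C_mul, map_mul, map_C, ← smul_eq_C_mul, map_smul, hx, smul_zero]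

/-- One reduction per couple suffices. The S-polynomial is supported on `O` and its border, so it
can be reduced with trivial multipliers only, and `borderNF` is unchanged by such steps. -/
theorem NeighbourSyzygies.of_reduces {R A : Type*} [CommRing R] [CommRing A] (φ : R →+* A)
    {c : border O → O → R} (β : Fin m ≃ border O)
    (hβ : Monotone fun i => Finsupp.degree (β i : Term n))
    (H : ∀ r s : border O, IsNeighbourCouple (r : Term n) s → ∀ h,
      Reduces (fun τ : border O => (τ : Term n)) (borderMult β) (fun τ => markedPoly O τ (c τ))
        (sPoly (r : Term n) s (markedPoly O r (c r)) (markedPoly O s (c s))) h →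
      IsReduced O h → MvPolynomial.map φ h = 0) :
    NeighbourSyzygies fun τ σ => φ (c τ σ) := by
  intro r s hrs
  obtain ⟨h, h1, h2, h3⟩ := exists_reduces (O := O) (head := fun τ : border O => (τ : Term n))
    (mult := borderMult β) (c := c)
    -- The empty relation suffices: replacing a border term with multiplier `1` creates only terms
    -- of `O`.
    (Γ := {γ | γ ∈ O ∨ γ ∈ border O}) (r := fun _ _ => False)
    ⟨fun a => ⟨a, fun _ h => h.elim⟩⟩ (S := {p | p.2 = 0})
    (by
      rintro ⟨τ, η⟩ hη
      obtain rfl : η = 0 := hη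
      exact zero_mem_borderMult β hβ τ)
    (by
      rintro γ (hγ | hγ) hγO
      · exact absurd hγ hγO
      refine ⟨⟨⟨γ, hγ⟩, 0⟩, rfl, add_zero γ, fun σ hσ => ?_⟩
      dsimp only
      rw [zero_add]
      exact ⟨.inl hσ, fun h => h hσ⟩)
    _ (sPoly_neighbour_support _ hrs)
  have := borderNF_map_eq_zero φ h3
  rw [map_sub, H r s hrs h h1 h2, sub_zero, sPoly, map_sub, map_mul, map_mul, map_markedPoly,
    map_markedPoly, map_monomial, map_monomial, map_one] at this
  exact this

theorem neighbourSyzygies_mk (β : Fin m ≃ border O)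
    (hβ : Monotone fun i => Finsupp.degree (β i : Term n)) :
    NeighbourSyzygies (O := O) fun τ σ => Ideal.Quotient.mk (borderIdeal K O β) (X (τ, σ)) := by
  refine .of_reduces (Ideal.Quotient.mk (borderIdeal K O β)) (c := fun τ σ => X (τ, σ)) β hβ
    fun r s hrs h h1 h2 => ?_
  ext μ
  rw [coeff_map, coeff_zero, Ideal.Quotient.eq_zero_iff_mem]
  exact Ideal.subset_span ⟨r, s, hrs, h, h1, h2, μ, rfl⟩

theorem coeff_mem_borderIdeal (hO : IsLowerSet (O : Set (Term n))) (β : Fin m ≃ border O)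
    (hβ : Monotone fun i => Finsupp.degree (β i : Term n))
    {h : MvPolynomial (Fin n) (MvPolynomial (Param O) K)} (hh : IsReduced O h)
    (hI : h ∈ Ideal.span (Set.range (genericBorder K O))) (μ : Term n) :
    coeff μ h ∈ borderIdeal K O β := by
  rw [← Ideal.Quotient.eq_zero_iff_mem, ← coeff_map]
  rw [(neighbourSyzygies_mk (K := K) β hβ).eq_zero hO (hh.map _), coeff_zero]
  refine map_mem_span_range _ (fun τ => ?_) hI
  rw [genericBorder_eq, map_markedPoly]
  exact Ideal.subset_span ⟨τ, rfl⟩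

end BorderIdeal

/-! ### Combinatorics of Pommaret cones. -/

section PommaretTerms

variable {n : ℕ}

/-- The lexicographic order on terms, where the largest variable is compared first. -/
def lexLT : Term n → Term n → Prop := Finsupp.Lex (· > ·) (· < ·)

theorem lexLT_wf : WellFounded (lexLT (n := n)) :=
  Finsupp.Lex.wellFounded_of_finite _ wellFounded_lt

theorem lexLT.trans {a b c : Term n} (h1 : lexLT a b) (h2 : lexLT b c) : lexLT a c := by
  obtain ⟨i, hi, hi'⟩ := h1
  obtain ⟨j, hj, hj'⟩ := h2
  dsimp only at *
  rcases lt_trichotomy i j with h | rfl | h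
  · exact ⟨j, fun k hk => (hi k (h.trans hk)).trans (hj k hk), (hi j h).symm ▸ hj'⟩
  · exact ⟨i, fun k hk => (hi k hk).trans (hj k hk), hi'.trans hj'⟩
  · exact ⟨i, fun k hk => (hi k hk).trans (hj k (lt_trans h hk)), (hj i h) ▸ hi'⟩

theorem lexLT.add_left {a b : Term n} (c : Term n) (h : lexLT a b) : lexLT (c + a) (c + b) := by
  obtain ⟨i, hi, hi'⟩ := h
  refine ⟨i, fun k hk => ?_, ?_⟩
  · simpa using hi k hk
  · simpa using hi'

theorem pommaretMult_anti {α η η' : Term n} (h : η' ≤ η) (hη : η ∈ pommaretMult α) :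
    η' ∈ pommaretMult α := fun j hj => hη j (Finsupp.support_mono h hj)

theorem zero_mem_pommaretMult (α : Term n) : 0 ∈ pommaretMult α := by
  intro j hj
  simp at hj

/-- Let `k` be the largest index where `η` and `η'` differ. If `η'` had the larger exponent there,
`x_k` would divide `η'`, so `τ` would involve no variable below `x_k`; comparing exponents at and
above `k` would then give `τ ∣ a`. -/
theorem lexLT_of_add_eq {a η τ η' : Term n} (h : a + η = τ + η') (hη' : η' ∈ pommaretMult τ)
    (hle : ¬ τ ≤ a) : lexLT η' η := by
  classical
  have key : ∀ k, a k + η k = τ k + η' k := fun k => DFunLike.congr_fun h k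
  have hne : (Finset.univ.filter fun k => η' k ≠ η k).Nonempty := by
    by_contra hcon
    rw [Finset.not_nonempty_iff_eq_empty, Finset.filter_eq_empty_iff] at hcon
    refine hle fun k => ?_
    have h1 := hcon (Finset.mem_univ k)
    have h2 := key k
    push Not at h1
    omega
  obtain ⟨k, hk, hmax⟩ := Finset.exists_max_image _ id hne
  have hgt : ∀ j, j > k → η' j = η j := by
    intro j hj
    by_contra hcon
    exact absurd (hmax j (by simpa using hcon)) (not_le.2 hj)
  refine ⟨k, hgt, ?_⟩
  by_contra hlt
  have hk' : η' k ≠ η k := (Finset.mem_filter.1 hk).2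
  refine hle fun j => ?_
  have hj := key j
  rcases lt_trichotomy j k with h' | rfl | h'
  · have : τ j = 0 := by
      by_contra hτ
      exact absurd (hη' k (Finsupp.mem_support_iff.2 (by omega)) j
        (Finsupp.mem_support_iff.2 hτ)) (not_le.2 h')
    omega
  · omega
  · have := hgt j h'
    omega

variable {O : Finset (Term n)}

/-- If `ε ≠ 1`, the smallest variable of `τ ε` can be removed from `ε`; the quotient is still a
multiple of `τ`, hence outside `O`, against membership in the Pommaret basis. -/
theorem eq_zero_of_add_mem_pommaretBasis {τ ε : Term n} (hO : IsLowerSet (O : Set (Term n)))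
    (h : τ + ε ∈ pommaretBasis O) (hτ : τ ∉ O) (hε : ε ∈ pommaretMult τ) : ε = 0 := by
  by_contra hne
  have hs : ε.support.Nonempty := Finsupp.support_nonempty_iff.2 hne
  set i := ε.support.min' hs
  have hi : i ∈ ε.support := Finset.min'_mem _ _
  have hle : Finsupp.single i 1 ≤ ε :=
    Finsupp.single_le_iff.2 (Nat.one_le_iff_ne_zero.2 (Finsupp.mem_support_iff.1 hi))
  have hm := h.2 i ⟨by
    simp only [Finset.mem_coe, Finsupp.mem_support_iff, Finsupp.add_apply] at hi ⊢
    omega, by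
    intro j hj
    simp only [Finset.mem_coe, Finsupp.mem_support_iff, Finsupp.add_apply] at hj
    by_cases h0 : ε j = 0
    · exact hε i hi j (Finsupp.mem_support_iff.2 (by omega))
    · exact Finset.min'_le _ _ (Finsupp.mem_support_iff.2 h0)⟩
  rw [add_tsub_assoc_of_le hle] at hm
  exact hτ (hO le_self_add hm)

/-- If one head divides the other, their quotient is multiplicative and therefore trivial. Otherwise
`lexLT_of_add_eq` applies in both directions and makes `η` and `η'` each smaller than the other. -/
theorem pommaret_decomposition_unique (hO : IsLowerSet (O : Set (Term n))) {τ τ' η η' : Term n}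
    (hτ : τ ∈ pommaretBasis O) (hτ' : τ' ∈ pommaretBasis O) (hη : η ∈ pommaretMult τ)
    (hη' : η' ∈ pommaretMult τ') (h : τ + η = τ' + η') : τ = τ' ∧ η = η' := by
  have key : ∀ {τ τ' η η' : Term n}, τ ∈ pommaretBasis O → τ' ∈ pommaretBasis O →
      η' ∈ pommaretMult τ' → τ + η = τ' + η' → τ' ≤ τ → τ = τ' ∧ η = η' := by
    intro τ τ' η η' hτ hτ' hη' h hle
    obtain ⟨ε, rfl⟩ := exists_add_of_le hle
    rw [add_assoc] at h
    have h' := add_left_cancel h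
    obtain rfl := eq_zero_of_add_mem_pommaretBasis hO hτ hτ'.1
      (pommaretMult_anti (h' ▸ le_self_add) hη')
    exact ⟨add_zero _, by rw [← h', zero_add]⟩
  by_cases h1 : τ' ≤ τ
  · exact key hτ hτ' hη' h h1
  by_cases h2 : τ ≤ τ'
  · exact (key hτ' hτ hη h.symm h2).imp Eq.symm Eq.symm
  exact absurd (lexLT_of_add_eq h hη' h1)
    (lexLT_wf.asymmetric _ _ (lexLT_of_add_eq h.symm hη h2))

/-- Dividing by the smallest variable until the next division would enter `O` stops at a head; every
variable removed is at most the smallest one that remains. -/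
theorem exists_pommaret_decomposition (h0 : (0 : Term n) ∈ O) {γ : Term n} (hγ : γ ∉ O) :
    ∃ τ : PommaretHead O, ∃ η ∈ pommaretMult (τ.1 : Term n), (τ.1 : Term n) + η = γ := by
  induction γ using WellFoundedLT.induction with
  | _ γ ih =>
  have hs : γ.support.Nonempty := Finsupp.support_nonempty_iff.2 fun h => hγ (h ▸ h0)
  set i := γ.support.min' hs
  have hi : i ∈ γ.support := Finset.min'_mem _ _
  have hle : Finsupp.single i 1 ≤ γ :=
    Finsupp.single_le_iff.2 (Nat.one_le_iff_ne_zero.2 (Finsupp.mem_support_iff.1 hi))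
  have hmin : ∀ j ∈ γ.support, i ≤ j := fun j hj => Finset.min'_le _ _ hj
  have hsub : γ - Finsupp.single i 1 + Finsupp.single i 1 = γ := tsub_add_cancel_of_le hle
  by_cases hm : γ - Finsupp.single i 1 ∈ O
  · refine ⟨⟨⟨γ, mem_border.2 ⟨⟨_, hm, i, hsub⟩, hγ⟩⟩, hγ, fun j hj => ?_⟩, 0,
      zero_mem_pommaretMult _, add_zero _⟩
    rwa [le_antisymm (hj.2 hi) (hmin j hj.1)]
  · obtain ⟨τ, η, hη, h⟩ := ih (γ - Finsupp.single i 1)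
      (by
        conv_rhs => rw [← hsub]
        exact lt_add_of_pos_right _ (by simp [pos_iff_ne_zero])) hm
    refine ⟨τ, η + Finsupp.single i 1, fun j hj k hk => ?_, by rw [← add_assoc, h, hsub]⟩
    have hk' : k ∈ γ.support := by
      rw [← hsub, ← h]
      simp only [Finsupp.mem_support_iff, Finsupp.add_apply] at hk ⊢
      omega
    by_cases hj' : j ∈ η.support
    · exact hη j hj' k hk
    · obtain rfl : i = j := by
        by_contra hij
        simp only [Finsupp.mem_support_iff, Finsupp.add_apply] at hj hj'
        rw [Finsupp.single_apply, if_neg hij] at hj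
        omega
      exact hmin k hk'

/-- The factor `η` of the decomposition `γ = τ η` with `τ` in the Pommaret basis and `η`
multiplicative for `τ`. -/
noncomputable def pommaretQuot (O : Finset (Term n)) (γ : Term n) : Term n :=
  open Classical in
  if h : ∃ η, ∃ τ ∈ pommaretBasis O, η ∈ pommaretMult τ ∧ τ + η = γ then h.choose else 0

theorem pommaretQuot_add (hO : IsLowerSet (O : Set (Term n))) {τ η : Term n}
    (hτ : τ ∈ pommaretBasis O) (hη : η ∈ pommaretMult τ) : pommaretQuot O (τ + η) = η := by
  have h : ∃ η', ∃ τ' ∈ pommaretBasis O, η' ∈ pommaretMult τ' ∧ τ' + η' = τ + η :=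
    ⟨η, τ, hτ, hη, rfl⟩
  rw [pommaretQuot, dif_pos h]
  obtain ⟨τ', hτ', hη', h'⟩ := h.choose_spec
  exact (pommaret_decomposition_unique hO hτ' hτ hη' hη h').2

/-- This is what makes Pommaret reduction terminate: the tail terms `η σ` of `η b_τ` that need
further reduction have strictly smaller multipliers. -/
theorem lexLT_pommaretQuot (hO : IsLowerSet (O : Set (Term n))) (h0 : (0 : Term n) ∈ O)
    {η σ : Term n} (hσ : σ ∈ O) (h : η + σ ∉ O) : lexLT (pommaretQuot O (η + σ)) η := by
  obtain ⟨τ, η', hη', he⟩ := exists_pommaret_decomposition h0 h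
  rw [← he, pommaretQuot_add hO τ.2 hη']
  exact lexLT_of_add_eq ((add_comm σ η).trans he.symm) hη' fun hle => τ.2.1 (hO hle hσ)

/-- For `x_i τ = δ s` with `x_i` not multiplicative for `τ` and `δ` multiplicative for `s`, the
term `s` does not divide `τ`. -/
theorem not_le_of_nonMult (hO : IsLowerSet (O : Set (Term n))) {τ s δ : Term n} {i : Fin n}
    (hτ : τ ∈ pommaretBasis O) (hs : s ∈ pommaretBasis O)
    (hi : Finsupp.single i 1 ∉ pommaretMult τ) (hδ : δ ∈ pommaretMult s)
    (h : Finsupp.single i 1 + τ = s + δ) : ¬ s ≤ τ := by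
  intro hle
  obtain ⟨ε, rfl⟩ := exists_add_of_le hle
  have he : ε + Finsupp.single i 1 = δ := by
    rw [add_left_comm] at h
    rw [← add_left_cancel h, add_comm]
  obtain rfl := eq_zero_of_add_mem_pommaretBasis hO hτ hs.1
    (pommaretMult_anti (he ▸ le_self_add) hδ)
  rw [add_zero, zero_add] at *
  exact hi (he ▸ hδ)

/-- Since `s` divides `x_i τ` but not `τ`, it exceeds `τ` exactly in the exponent of `x_i`. The
S-polynomial of a nonmultiplicative couple is thus `x_i b_τ - δ b_s`. -/
theorem sup_eq_of_not_le {τ s δ : Term n} {i : Fin n} (h : Finsupp.single i 1 + τ = s + δ)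
    (hle : ¬ s ≤ τ) : τ ⊔ s = Finsupp.single i 1 + τ := by
  have key : ∀ k, (Finsupp.single i 1 : Term n) k + τ k = s k + δ k :=
    fun k => DFunLike.congr_fun h k
  have hi : ¬ s i ≤ τ i := by
    refine fun hi => hle fun j => ?_
    by_cases hij : i = j
    · exact hij ▸ hi
    · have := key j
      rw [Finsupp.single_apply, if_neg hij] at this
      omega
  ext k
  have := key k
  rw [Finsupp.sup_apply, Finsupp.add_apply]
  by_cases hik : i = k
  · subst hik
    rw [Finsupp.single_eq_same] at *
    omega
  · rw [Finsupp.single_apply, if_neg hik] at *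
    omega

end PommaretTerms

/-! ### Pommaret normal forms and the syzygy criterion. -/

section Pommaret

variable {n : ℕ} {A : Type*} [CommRing A] {O : Finset (Term n)}

/-- Every polynomial with nonreduced terms of quotient in a lower set has a reduction. -/
theorem exists_pommaret_reduces (hO : IsLowerSet (O : Set (Term n))) (h0 : (0 : Term n) ∈ O)
    (c : PommaretHead O → O → A) {D : Set (Term n)} (hD : ∀ a b, lexLT a b → b ∈ D → a ∈ D)
    (g : MvPolynomial (Fin n) A) (hg : ∀ γ ∈ g.support, γ ∉ O → pommaretQuot O γ ∈ D) :
    ∃ h, Reduces (fun τ : PommaretHead O => (τ.1 : Term n))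
        (fun τ : PommaretHead O => pommaretMult (τ.1 : Term n))
        (fun τ => markedPoly O τ.1 (c τ)) g h ∧ IsReduced O h ∧
      g - h ∈ Submodule.span A ((fun p : PommaretHead O × Term n =>
        monomial p.2 1 * markedPoly O p.1.1 (c p.1)) ''
          {p | p.2 ∈ pommaretMult (p.1.1 : Term n) ∧ p.2 ∈ D}) := by
  refine exists_reduces (head := fun τ : PommaretHead O => (τ.1 : Term n))
    (r := InvImage lexLT (pommaretQuot O)) (InvImage.wf _ lexLT_wf)
    (Γ := {γ | γ ∉ O → pommaretQuot O γ ∈ D}) (fun p hp => hp.1) ?_ g hg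
  intro γ hγ hγO
  obtain ⟨τ, η, hη, rfl⟩ := exists_pommaret_decomposition h0 hγO
  have hηD : η ∈ D := pommaretQuot_add hO τ.2 hη ▸ hγ hγO
  refine ⟨(τ, η), ⟨hη, hηD⟩, rfl, fun σ hσ => ⟨fun h => ?_, fun h => ?_⟩⟩
  · exact hD _ _ (lexLT_pommaretQuot hO h0 hσ h) hηD
  · rw [InvImage, pommaretQuot_add hO τ.2 hη]
    exact lexLT_pommaretQuot hO h0 hσ h

/-- Uniqueness of the decomposition leaves only one way to rewrite a nonreduced term, so a linear
normal form can be defined by recursion on the multiplier, whatever the coefficients `c`. -/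
theorem exists_pommaretNF (hO : IsLowerSet (O : Set (Term n))) (h0 : (0 : Term n) ∈ O)
    (c : PommaretHead O → O → A) :
    ∃ N : MvPolynomial (Fin n) A →ₗ[A] MvPolynomial (Fin n) A,
      (∀ h, IsReduced O h → N h = h) ∧
      ∀ (τ : PommaretHead O), ∀ η ∈ pommaretMult (τ.1 : Term n),
        N (monomial η 1 * markedPoly O τ.1 (c τ)) = 0 := by
  classical
  let r : Term n → Term n → Prop := InvImage lexLT (pommaretQuot O)
  have hr : WellFounded r := InvImage.wf _ lexLT_wf
  let F : (γ : Term n) → ((δ : Term n) → r δ γ → MvPolynomial (Fin n) A) →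
      MvPolynomial (Fin n) A := fun γ rec =>
    if h : ∃ p : PommaretHead O × Term n,
      p.2 ∈ pommaretMult (p.1.1 : Term n) ∧ (p.1.1 : Term n) + p.2 = γ then
      ∑ σ : O, c h.choose.1 σ • if h.choose.2 + σ ∈ O then monomial (h.choose.2 + σ : Term n) 1
        -- The final default `0` is never reached, because the quotient of a nonreduced `η σ` is
        -- smaller by `lexLT_pommaretQuot`; the test only licenses the recursive call.
        else if hlt : r (h.choose.2 + σ) γ then rec _ hlt else 0
    else 0
  let G : Term n → MvPolynomial (Fin n) A := fun γ =>
    if γ ∈ O then monomial γ 1 else hr.fix F γ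
  have hGO : ∀ γ ∈ O, G γ = monomial γ 1 := fun γ hγ => if_pos hγ
  have hG : ∀ (τ : PommaretHead O), ∀ η ∈ pommaretMult (τ.1 : Term n),
      G (τ.1 + η) = ∑ σ : O, c τ σ • G (η + σ) := by
    intro τ η hη
    have hnot : (τ.1 : Term n) + η ∉ O := fun h => τ.2.1 (hO le_self_add h)
    have hex : ∃ p : PommaretHead O × Term n,
      p.2 ∈ pommaretMult (p.1.1 : Term n) ∧ (p.1.1 : Term n) + p.2 = τ.1 + η := ⟨(τ, η), hη, rfl⟩
    have hch : hex.choose = (τ, η) := by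
      obtain ⟨h1, h2⟩ := hex.choose_spec
      obtain ⟨h3, h4⟩ := pommaret_decomposition_unique hO hex.choose.1.2 τ.2 h1 hη h2
      exact Prod.ext (Subtype.ext (Subtype.ext h3)) h4
    simp only [G]
    rw [if_neg hnot, hr.fix_eq]
    simp only [F]
    rw [dif_pos hex, hch]
    refine Finset.sum_congr rfl fun σ _ => ?_
    congr 1
    split_ifs with h1 h2
    · rfl
    · rfl
    · refine absurd ?_ h2
      rw [show r _ _ = lexLT _ _ from rfl, pommaretQuot_add hO τ.2 hη]
      exact lexLT_pommaretQuot hO h0 σ.2 h1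
  let N := (basisMonomials (Fin n) A).constr A G
  have hN : ∀ (γ : Term n) (a : A), N (monomial γ a) = a • G γ := by
    intro γ a
    have := (basisMonomials (Fin n) A).constr_basis A G γ
    rw [coe_basisMonomials] at this
    rw [← this, ← map_smul, smul_monomial, smul_eq_mul, mul_one]
  refine ⟨N, fun h hh => ?_, fun τ η hη => ?_⟩
  · rw [hh.eq_sum, map_sum]
    refine Finset.sum_congr rfl fun σ _ => ?_
    rw [hN, hGO σ σ.2, smul_monomial, smul_eq_mul, mul_one]
  · rw [monomial_mul_markedPoly, map_sub, map_sum, hN, one_smul, add_comm η, hG τ η hη, sub_eq_zero]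
    refine Finset.sum_congr rfl fun σ _ => ?_
    rw [hN, one_mul]

/-- If `ε` is not multiplicative for `τ`, some nonmultiplicative `x_i` divides it. The syzygy of
`x_i b_τ` expresses it by multiples with multipliers below `x_i`, up to a remainder with
coefficients in `I`. Multiplying by `ε / x_i` keeps these multipliers below `ε`, though perhaps no
longer multiplicative, so induction on `ε` over all heads applies. -/
theorem monomial_mul_mem_of_nonMult_syzygies (hO : IsLowerSet (O : Set (Term n)))
    (h0 : (0 : Term n) ∈ O) (c : PommaretHead O → O → A) (I : Ideal A)
    (H : ∀ r s : PommaretHead O, IsNonMultCouple pommaretMult (r.1 : Term n) (s.1 : Term n) → ∀ h,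
      Reduces (fun τ : PommaretHead O => (τ.1 : Term n))
        (fun τ : PommaretHead O => pommaretMult (τ.1 : Term n))
        (fun τ => markedPoly O τ.1 (c τ))
        (sPoly (r.1 : Term n) s.1 (markedPoly O r.1 (c r)) (markedPoly O s.1 (c s))) h →
      IsReduced O h → ∀ μ, coeff μ h ∈ I) (ε : Term n) (τ : PommaretHead O) :
    monomial ε 1 * markedPoly O τ.1 (c τ) ∈
      Submodule.span A {v | ∃ (τ : PommaretHead O), ∃ η ∈ pommaretMult (τ.1 : Term n),
        monomial η 1 * markedPoly O τ.1 (c τ) = v} ⊔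
      (Ideal.map (C (σ := Fin n)) I).restrictScalars A := by
  induction ε using lexLT_wf.induction generalizing τ with
  | _ ε ih =>
  by_cases hε : ε ∈ pommaretMult (τ.1 : Term n)
  · exact Submodule.mem_sup_left (Submodule.subset_span ⟨τ, ε, hε, rfl⟩)
  obtain ⟨i, hi, k, hk, hik⟩ : ∃ i ∈ ε.support, ∃ k ∈ (τ.1 : Term n).support, ¬ i ≤ k := by
    by_contra hcon
    push Not at hcon
    exact hε hcon
  have hnm : Finsupp.single i 1 ∉ pommaretMult (τ.1 : Term n) :=
    fun h => hik (h i (by simp) k hk)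
  obtain ⟨ε', rfl⟩ : ∃ ε', ε = ε' + Finsupp.single i 1 :=
    ⟨_, (tsub_add_cancel_of_le (Finsupp.single_le_iff.2
      (Nat.one_le_iff_ne_zero.2 (Finsupp.mem_support_iff.1 hi)))).symm⟩
  obtain ⟨s, δ, hδ, hs⟩ := exists_pommaret_decomposition (O := O) h0
    (γ := Finsupp.single i 1 + (τ.1 : Term n)) fun h => τ.2.1 (hO le_add_self h)
  have hnle := not_le_of_nonMult hO τ.2 s.2 hnm hδ hs.symm
  have hsup := sup_eq_of_not_le hs.symm hnle
  have hδi : lexLT δ (Finsupp.single i 1) :=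
    lexLT_of_add_eq ((add_comm _ _).trans hs.symm) hδ hnle
  set S := sPoly (τ.1 : Term n) s.1 (markedPoly O τ.1 (c τ)) (markedPoly O s.1 (c s)) with hSdef
  have hS : S = monomial (Finsupp.single i 1) 1 * markedPoly O τ.1 (c τ) -
      monomial δ 1 * markedPoly O s.1 (c s) := by
    rw [hSdef, sPoly, hsup, add_tsub_cancel_right, ← hs, add_tsub_cancel_left]
  -- `D` records that the whole reduction of `S` uses only multipliers smaller than `x_i`, which the
  -- induction requires.
  let D : Set (Term n) := {η | lexLT η (Finsupp.single i 1)}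
  have hSsupp : S ∈ restrictSupport A {γ | γ ∉ O → pommaretQuot O γ ∈ D} := by
    rw [hS, monomial_mul_markedPoly, monomial_mul_markedPoly, add_comm δ, hs,
      sub_sub_sub_cancel_left]
    refine sub_mem (Submodule.sum_mem _ fun σ _ => ?_) (Submodule.sum_mem _ fun σ _ => ?_) <;>
      refine (monomial_mem_restrictSupport A).2 (.inl fun h => ?_)
    · exact (lexLT_pommaretQuot hO h0 σ.2 h).trans hδi
    · exact lexLT_pommaretQuot hO h0 σ.2 h
  obtain ⟨h, h1, h2, h3⟩ := exists_pommaret_reduces hO h0 c (D := D)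
    (fun a b hab hb => hab.trans hb) S (fun γ hγ => (mem_restrictSupport_iff A).1 hSsupp hγ)
  have hcoeff := H τ s ⟨i, hnm, δ, hδ, hs.symm⟩ h h1 h2
  have hsplit : monomial (ε' + Finsupp.single i 1) 1 * markedPoly O τ.1 (c τ) =
      monomial (ε' + δ) 1 * markedPoly O s.1 (c s) + monomial ε' 1 * (S - h) +
        monomial ε' 1 * h := by
    have e : ∀ a b : Term n, (monomial (a + b) 1 : MvPolynomial (Fin n) A) =
      monomial a 1 * monomial b 1 := fun a b => by rw [monomial_mul, one_mul]
    rw [e, e, hS]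
    ring
  rw [hsplit]
  refine add_mem (add_mem (ih _ (hδi.add_left ε') s) ?_) (Submodule.mem_sup_right ?_)
  · generalize S - h = g at h3
    induction h3 using Submodule.span_induction with
    | mem x hx =>
      obtain ⟨⟨τ', η⟩, ⟨-, hη⟩, rfl⟩ := hx
      dsimp only
      rw [← mul_assoc, monomial_mul, one_mul]
      exact ih _ (lexLT.add_left ε' hη) τ'
    | zero => simp
    | add x y _ _ hx hy => rw [mul_add]; exact add_mem hx hy
    | smul a x _ hx => rw [mul_smul_comm]; exact Submodule.smul_mem _ _ hx
  · exact Ideal.mul_mem_left _ _ (mem_map_C_iff.2 hcoeff)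

/-- If the `S`-polynomials of the nonmultiplicative couples reduce to polynomials with coefficients
in `I`, then so do the elements of the ideal of the Pommaret marked set. -/
theorem coeff_mem_of_nonMult_syzygies (hO : IsLowerSet (O : Set (Term n)))
    (h0 : (0 : Term n) ∈ O) (c : PommaretHead O → O → A) (I : Ideal A)
    (H : ∀ r s : PommaretHead O, IsNonMultCouple pommaretMult (r.1 : Term n) (s.1 : Term n) → ∀ h,
      Reduces (fun τ : PommaretHead O => (τ.1 : Term n))
        (fun τ : PommaretHead O => pommaretMult (τ.1 : Term n))
        (fun τ => markedPoly O τ.1 (c τ))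
        (sPoly (r.1 : Term n) s.1 (markedPoly O r.1 (c r)) (markedPoly O s.1 (c s))) h →
      IsReduced O h → ∀ μ, coeff μ h ∈ I)
    {h : MvPolynomial (Fin n) A} (hh : IsReduced O h)
    (hI : h ∈ Ideal.span (Set.range fun τ : PommaretHead O => markedPoly O τ.1 (c τ)))
    (μ : Term n) : coeff μ h ∈ I := by
  obtain ⟨N, hN, hN0⟩ := exists_pommaretNF hO h0 c
  have hV : h ∈ Submodule.span A {v | ∃ (τ : PommaretHead O), ∃ η ∈ pommaretMult (τ.1 : Term n),
        monomial η 1 * markedPoly O τ.1 (c τ) = v} ⊔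
      (Ideal.map (C (σ := Fin n)) I).restrictScalars A := by
    classical
    obtain ⟨f, rfl⟩ := Ideal.mem_span_range_iff_exists_fun.1 hI
    refine Submodule.sum_mem _ fun τ _ => ?_
    rw [(f τ).as_sum, Finset.sum_mul]
    refine Submodule.sum_mem _ fun ε _ => ?_
    rw [monomial_eq_smul_one, smul_mul_assoc]
    exact Submodule.smul_mem _ _ (monomial_mul_mem_of_nonMult_syzygies hO h0 c I H ε τ)
  obtain ⟨v, hv, w, hw, rfl⟩ := Submodule.mem_sup.1 hV
  have hNv : N v = 0 := by
    refine LinearMap.mem_ker.1 (Submodule.span_le.2 ?_ hv)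
    rintro _ ⟨τ, η, hη, rfl⟩
    exact hN0 τ η hη
  -- Hence `h = N w`; as `N` is linear over the coefficient ring, the coefficients of `N w` remain
  -- in `I`.
  rw [← hN _ hh, map_add, hNv, zero_add, w.as_sum, map_sum, coeff_sum]
  refine sum_mem fun γ _ => ?_
  rw [monomial_eq_smul_one, map_smul, coeff_smul, smul_eq_mul]
  exact Ideal.mul_mem_right _ _ (mem_map_C_iff.1 hw γ)

end Pommaret

/-! ### Comparing the two ideals along maps of the parameters. -/

section Comparison

variable {n : ℕ} {K : Type*} [Field K] {O : Finset (Term n)} {m : ℕ}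

theorem coeff_mem_pommaretIdeal (hO : IsLowerSet (O : Set (Term n))) (h0 : (0 : Term n) ∈ O)
    {h : MvPolynomial (Fin n) (MvPolynomial ↥(elimParam O)ᶜ K)} (hh : IsReduced O h)
    (hI : h ∈ Ideal.span (Set.range (genericPommaret K O))) (μ : Term n) :
    coeff μ h ∈ pommaretIdeal K O :=
  coeff_mem_of_nonMult_syzygies hO h0
    (fun (τ : PommaretHead O) σ =>
      (X ⟨(τ.1, σ), fun h => h τ.2⟩ : MvPolynomial ↥(elimParam O)ᶜ K)) (pommaretIdeal K O)
    (fun r s hrs g h1 h2 ν => Ideal.subset_span ⟨r, s, hrs, g, h1, h2, ν, rfl⟩) hh hI μ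

theorem pommaretIdeal_le_comap (hO : IsLowerSet (O : Set (Term n))) (β : Fin m ≃ border O)
    (hβ : Monotone fun i => Finsupp.degree (β i : Term n)) :
    pommaretIdeal K O ≤ Ideal.comap (rename (R := K)
      (Subtype.val : ↥(elimParam O)ᶜ → Param O)) (borderIdeal K O β) := by
  refine Ideal.span_le.2 ?_
  rintro _ ⟨r, s, -, h, h1, h2, μ, rfl⟩
  have hmem : h ∈ Ideal.span (Set.range (genericPommaret K O)) :=
    Reduces.mem_span_of_sPoly h1
  obtain ⟨φ, hφr⟩ : ∃ φ : MvPolynomial ↥(elimParam O)ᶜ K →+* MvPolynomial (Param O) K,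
      ∀ f, φ f = rename (R := K) (Subtype.val : ↥(elimParam O)ᶜ → Param O) f :=
    ⟨(rename (R := K) (Subtype.val : ↥(elimParam O)ᶜ → Param O)).toRingHom, fun _ => rfl⟩
  have hφX : ∀ p, φ (X p) = X (p : Param O) := fun p => (hφr _).trans (rename_X _ p)
  have hφ : MvPolynomial.map φ h ∈ Ideal.span (Set.range (genericBorder K O)) := by
    refine map_mem_span_range φ (fun τ => Ideal.subset_span ⟨τ.1, ?_⟩) hmem
    rw [genericPommaret_eq, map_markedPoly, genericBorder_eq]
    refine congrArg (markedPoly O _) (funext fun σ => ?_)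
    exact (hφX ⟨(τ.1, σ), fun h => h τ.2⟩).symm
  have := coeff_mem_borderIdeal hO β hβ (h2.map φ) hφ μ
  rw [coeff_map, hφr] at this
  exact this

theorem exists_normalForm (hO : IsLowerSet (O : Set (Term n))) (h0 : (0 : Term n) ∈ O)
    (τ : Term n) : ∃ h, IsReduced O h ∧
      monomial τ 1 - h ∈ Ideal.span (Set.range (genericPommaret K O)) := by
  obtain ⟨h, h1, h2, -⟩ := exists_pommaret_reduces hO h0
    (fun (τ : PommaretHead O) σ =>
      (X ⟨(τ.1, σ), fun h => h τ.2⟩ : MvPolynomial ↥(elimParam O)ᶜ K))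
    (D := Set.univ) (fun _ _ _ _ => trivial) (monomial τ 1) (fun _ _ _ => trivial)
  exact ⟨h, h2, h1.sub_mem⟩

theorem comap_le_pommaretIdeal (hO : IsLowerSet (O : Set (Term n))) (h0 : (0 : Term n) ∈ O)
    (β : Fin m ≃ border O) :
    Ideal.comap (rename (R := K)
      (Subtype.val : ↥(elimParam O)ᶜ → Param O)) (borderIdeal K O β) ≤ pommaretIdeal K O := by
  classical
  choose nf hnf hnf' using exists_normalForm (K := K) hO h0
  -- The retraction eliminates `C̃`: its parameters become the coefficients of a chosen Pommaret
  -- normal form of the head term. Any choice of `nf` works.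
  let v : Param O → MvPolynomial ↥(elimParam O)ᶜ K := fun p =>
    if hp : p ∈ (elimParam O)ᶜ then X ⟨p, hp⟩ else coeff (p.2 : Term n) (nf (p.1 : Term n))
  let φ : MvPolynomial (Param O) K →+* MvPolynomial ↥(elimParam O)ᶜ K := (aeval v).toRingHom
  have hφX : ∀ p, φ (X p) = v p := fun p => aeval_X v p
  have hφ : ∀ f, φ (rename (R := K) (Subtype.val : ↥(elimParam O)ᶜ → Param O) f) = f := by
    intro f
    change aeval v (rename _ f) = f
    rw [aeval_rename]
    convert aeval_X_left_apply f using 2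
    congr 1
    funext p
    exact dif_pos p.2
  have hb : ∀ τ, MvPolynomial.map φ (genericBorder K O τ) ∈
      Ideal.span (Set.range (genericPommaret K O)) := by
    intro τ
    rw [genericBorder_eq, map_markedPoly]
    by_cases hτ : (τ : Term n) ∈ pommaretBasis O
    · refine Ideal.subset_span ⟨⟨τ, hτ⟩, ?_⟩
      rw [genericPommaret_eq]
      congr 1
      funext σ
      rw [hφX]
      have hmem : (τ, σ) ∈ (elimParam O)ᶜ := fun h => h hτ
      exact (show v (τ, σ) = X ⟨(τ, σ), hmem⟩ from dif_pos hmem).symm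
    · have : (fun σ => φ (X (τ, σ))) = fun σ : O => coeff (σ : Term n) (nf (τ : Term n)) := by
        funext σ
        rw [hφX]
        have hmem : (τ, σ) ∉ (elimParam O)ᶜ := fun h => h hτ
        exact dif_neg hmem
      rw [this, markedPoly, ← (hnf τ).eq_sum]
      exact hnf' τ
  have hle : borderIdeal K O β ≤ (pommaretIdeal K O).comap φ := by
    refine Ideal.span_le.2 ?_
    rintro _ ⟨r, s, -, h, h1, h2, μ, rfl⟩
    have hmem : h ∈ Ideal.span (Set.range (genericBorder K O)) :=
      Reduces.mem_span_of_sPoly h1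
    change φ (coeff μ h) ∈ pommaretIdeal K O
    rw [← coeff_map]
    refine coeff_mem_pommaretIdeal hO h0 (h2.map φ) (map_mem_span_range φ hb hmem) μ
  intro f hf
  rw [← hφ f]
  exact hle hf

end Comparison

end MarkedScheme

/-- For a finite order ideal `O` and any listing of its border by increasing degree,
`𝔓 = 𝔅 ∩ K[C ∖ C̃]`. -/
theorem corollary4p2 {K : Type*} [Field K] {n : ℕ} (O : Finset (MarkedScheme.Term n))
    (hO : IsLowerSet (O : Set (MarkedScheme.Term n)))
    {m : ℕ} (β : Fin m ≃ MarkedScheme.border O)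
    (hβ : Monotone fun i => Finsupp.degree (β i : MarkedScheme.Term n)) :
    MarkedScheme.pommaretIdeal K O =
      Ideal.comap
        (MvPolynomial.rename (R := K)
          (Subtype.val : ↥(MarkedScheme.elimParam O)ᶜ → MarkedScheme.Param O))
        (MarkedScheme.borderIdeal K O β) := by
  refine le_antisymm (MarkedScheme.pommaretIdeal_le_comap hO β hβ) ?_
  by_cases h0 : (0 : MarkedScheme.Term n) ∈ O
  · exact MarkedScheme.comap_le_pommaretIdeal hO h0 β
  -- A nonempty order ideal contains `1`, so here `O` and its border are empty and there are no
  -- S-polynomials.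
  have hB : MarkedScheme.borderIdeal K O β = ⊥ := by
    refine Ideal.span_eq_bot.2 ?_
    rintro _ ⟨r, -⟩
    obtain ⟨⟨σ, hσ, -⟩, -⟩ := MarkedScheme.mem_border.1 r.2
    exact absurd (hO (show 0 ≤ σ by simp) hσ) h0
  intro f hf
  rw [Ideal.mem_comap, hB, Ideal.mem_bot] at hf
  rw [rename_injective _ Subtype.val_injective (hf.trans (map_zero _).symm)]
  exact zero_mem _
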